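/- **Theorem 3.3.** For $k,m\ge 0$ let $Q_{k,m}$ be the set of multi-indices $I=(i_1,\dots,i_k)$ with $1\le i_1<\dots<i_k\le m$ (empty if $k>m$), and put $|I|=i_1+\dots+i_k$. For an $n\times n$ complex matrix $A$ let $g_r(A)$ be the $r$-th coefficient of its characteristic polynomial, written as $x^n-g_1(A)x^{n-1}+g_2(A)x^{n-2}-\dots+(-1)^n g_n(A)$, and for $I\in Q_{r,n}$ let $A_I$ be the $r\times r$ principal submatrix of $A$ on the rows and columns $I$. Let $\wedge^k\mathbb C^r\subseteq\otimes^k\mathbb C^r$ be the space of antisymmetric tensors, with basis $e_J=e_{j_1}\wedge\dots\wedge e_{j_k}$, $J\in Q_{k,r}$, where $e_1,\dots,e_r$ is the standard basis of $\mathbb C^r$ and $v_1\wedge\dots\wedge v_k=\frac1{\sqrt{k!}}\sum_{\sigma\in S_k}\operatorname{sgn}(\sigma)\,v_{\sigma(1)}\otimes\dots\otimes v_{\sigma(k)}$. For an $r\times r$ matrix $B$, let $\tilde\wedge^{r-k}B$ be the operator on $\wedge^k\mathbb C^r$ whose matrix in the basis $(e_J)$ is the transpose of the matrix with $(J,K)$-entry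 $(-1)^{|J|+|K|}\det B(J|K)$, where $B(J|K)$ is $B$ with the rows $J$ and the columns $K$ deleted. For $r\times r$ matrices $Y^1,\dots,Y^k$ let $Y^1\wedge\dots\wedge Y^k$ be the restriction to $\wedge^k\mathbb C^r$ of the operator $\frac1{k!}\sum_{\sigma\in S_k}Y^{\sigma(1)}\otimes\dots\otimes Y^{\sigma(k)}$, and let $\wedge^kY$ be the restriction of $Y\otimes\dots\otimes Y$. (If $k>r$, then $\wedge^k\mathbb C^r=0$ and every trace below is $0$.) Let $1\le k,r\le n$. Then $g_r$ is infinitely (complex) differentiable, and for all $n\times n$ complex matrices $A,X^1,\dots,X^k$ its $k$-th derivative at $A$ satisfies $$D^k g_r(A)(X^1,\dots,X^k)=k!\sum_{I\in Q_{r,n}}\operatorname{tr}\bigl[(\tilde\wedge^{r-k}A_I)(X^1_I\wedge\dots\wedge X^k_I)\bigr].$$ In particular, for every $n\times n$ complex matrix $X$, $$D^k g_r(A)(X,\dots,X)=k!\sum_{I\in Q_{r,n}}\operatorname{tr}\bigl[(\tilde\wedge^{r-k}A_I)(\wedge^kX_I)\bigr].$$ -/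

import Mathlib

open scoped TensorProduct

attribute [local instance] Matrix.instL2OpNormedAddCommGroup Matrix.instL2OpNormedSpace

noncomputable section

namespace CharCoeffDeriv

/-! ### Multi-indices and minors -/

/-- `Q k n`: the strictly increasing multi-indices `i₁ < ⋯ < i_k` with entries in `Fin n`
(the entries run over `0, …, n - 1` in place of `1, …, n`); it is empty for `k > n`. -/
abbrev Q (k n : ℕ) : Type := Fin k ↪o Fin n

instance instFintypeQ (k n : ℕ) : Fintype (Q k n) :=
  Fintype.ofEquiv _ (Set.powersetCard.ofFinEmbEquiv (n := k) (I := Fin n)).symm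

/-- The weight `|I| = i₁ + ⋯ + i_k`, computed with the entries in `1, …, n`. -/
def weight {k n : ℕ} (I : Q k n) : ℕ := ∑ p, ((I p : ℕ) + 1)

lemma card_compl_image {k n : ℕ} (I : Q k n) :
    ((Finset.univ.map I.toEmbedding)ᶜ : Finset (Fin n)).card = n - k := by
  rw [Finset.card_compl, Finset.card_map, Finset.card_univ, Fintype.card_fin, Fintype.card_fin]

/-- The increasing enumeration of the entries of `1, …, n` that do not occur in `I`. -/
def compl {k n : ℕ} (I : Q k n) : Q (n - k) n :=
  Finset.orderEmbOfFin (Finset.univ.map I.toEmbedding)ᶜ (card_compl_image I)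

/-- `A(I|J)`: the submatrix obtained from `A` by deleting the rows `I` and the columns `J`. -/
def deleted {k n : ℕ} (A : Matrix (Fin n) (Fin n) ℂ) (I J : Q k n) :
    Matrix (Fin (n - k)) (Fin (n - k)) ℂ :=
  A.submatrix (compl I) (compl J)

/-- `A_I = A[I|I]`: the principal submatrix of `A` on the rows and columns `I`. -/
def principal {r n : ℕ} (A : Matrix (Fin n) (Fin n) ℂ) (I : Q r n) :
    Matrix (Fin r) (Fin r) ℂ :=
  A.submatrix I I

/-- `g_r(A)`, where the characteristic polynomial of `A` is
`x^n - g₁ x^(n-1) + g₂ x^(n-2) - ⋯ + (-1)^n g_n` (used for `r ≤ n`). -/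
def g {n : ℕ} (r : ℕ) (A : Matrix (Fin n) (Fin n) ℂ) : ℂ :=
  (-1) ^ r * A.charpoly.coeff (n - r)

/-! ### Antisymmetric tensor powers -/

section Tensor

variable {V : Type*} [AddCommGroup V] [Module ℂ V]

/-- The antisymmetric tensor power `∧^k V`: the subspace of those tensors in `⊗^k V` which are
multiplied by the sign of the permutation whenever their tensor factors are permuted. -/
def antisym (k : ℕ) (V : Type*) [AddCommGroup V] [Module ℂ V] :
    Submodule ℂ (⨂[ℂ] _ : Fin k, V) where
  carrier := {t | ∀ σ : Equiv.Perm (Fin k),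
    PiTensorProduct.reindex ℂ (fun _ => V) σ t = ((Equiv.Perm.sign σ : ℤ) : ℂ) • t}
  add_mem' := fun ha hb σ => by rw [map_add, ha σ, hb σ, smul_add]
  zero_mem' := fun σ => by rw [map_zero, smul_zero]
  smul_mem' := fun c t ht σ => by rw [map_smul, ht σ, smul_comm]

lemma mem_antisym {k : ℕ} {t : ⨂[ℂ] _ : Fin k, V} :
    t ∈ antisym k V ↔ ∀ σ : Equiv.Perm (Fin k),
      PiTensorProduct.reindex ℂ (fun _ => V) σ t = ((Equiv.Perm.sign σ : ℤ) : ℂ) • t :=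
  Iff.rfl

/-- The operator `(1/k!) ∑_σ X^{σ(1)} ⊗ ⋯ ⊗ X^{σ(k)}` on `⊗^k V`. -/
def symTensor {k : ℕ} (X : Fin k → Module.End ℂ V) : Module.End ℂ (⨂[ℂ] _ : Fin k, V) :=
  (k.factorial : ℂ)⁻¹ • ∑ σ : Equiv.Perm (Fin k), PiTensorProduct.map fun i => X (σ i)

lemma symTensor_reindex {k : ℕ} (X : Fin k → Module.End ℂ V) (τ : Equiv.Perm (Fin k))
    (t : ⨂[ℂ] _ : Fin k, V) :
    PiTensorProduct.reindex ℂ (fun _ => V) τ (symTensor X t) =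
      symTensor X (PiTensorProduct.reindex ℂ (fun _ => V) τ t) := by
  induction t using PiTensorProduct.induction_on with
  | smul_tprod c f =>
    simp only [symTensor, map_smul, LinearMap.smul_apply, LinearMap.sum_apply, map_sum,
      PiTensorProduct.map_tprod, PiTensorProduct.reindex_tprod]
    congr 2
    refine Fintype.sum_equiv (Equiv.mulRight τ⁻¹) _ _ fun σ => ?_
    rfl
  | add x y hx hy => simp only [map_add, hx, hy]

lemma symTensor_mem {k : ℕ} (X : Fin k → Module.End ℂ V) :
    ∀ t ∈ antisym k V, symTensor X t ∈ antisym k V := by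
  intro t ht σ
  rw [symTensor_reindex, ht σ, map_smul]

/-- `X¹ ∧ ⋯ ∧ X^k`: the restriction of `(1/k!) ∑_σ X^{σ(1)} ⊗ ⋯ ⊗ X^{σ(k)}` to `∧^k V`. -/
def wedgeOp {k : ℕ} (X : Fin k → Module.End ℂ V) : Module.End ℂ (antisym k V) :=
  (symTensor X).restrict (symTensor_mem X)

lemma map_const_mem (k : ℕ) (X : Module.End ℂ V) :
    ∀ t ∈ antisym k V, PiTensorProduct.map (fun _ : Fin k => X) t ∈ antisym k V := by
  intro t ht σ
  have h : ∀ s : ⨂[ℂ] _ : Fin k, V,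
      PiTensorProduct.reindex ℂ (fun _ => V) σ (PiTensorProduct.map (fun _ : Fin k => X) s) =
      PiTensorProduct.map (fun _ : Fin k => X) (PiTensorProduct.reindex ℂ (fun _ => V) σ s) := by
    intro s
    induction s using PiTensorProduct.induction_on with
    | smul_tprod c f =>
      simp only [map_smul, PiTensorProduct.map_tprod, PiTensorProduct.reindex_tprod]
    | add x y hx hy => simp only [map_add, hx, hy]
  rw [h, ht σ, map_smul]

/-- The antisymmetric tensor power `∧^k X` of an operator: the restriction of `X ⊗ ⋯ ⊗ X`
to `∧^k V`. -/
def wedgePow (k : ℕ) (X : Module.End ℂ V) : Module.End ℂ (antisym k V) :=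
  (PiTensorProduct.map fun _ : Fin k => X).restrict (map_const_mem k X)

/-- The antisymmetrized tensor `∑_σ sgn(σ) v_{σ(1)} ⊗ ⋯ ⊗ v_{σ(k)}` of vectors. -/
def altSum {k : ℕ} (v : Fin k → V) : ⨂[ℂ] _ : Fin k, V :=
  ∑ σ : Equiv.Perm (Fin k),
    ((Equiv.Perm.sign σ : ℤ) : ℂ) • PiTensorProduct.tprod ℂ fun i => v (σ i)

lemma altSum_mem {k : ℕ} (v : Fin k → V) : altSum v ∈ antisym k V := by
  intro τ
  rw [altSum, map_sum, Finset.smul_sum]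
  refine Fintype.sum_equiv (Equiv.mulRight τ⁻¹) _ _ fun σ => ?_
  have hτ : (((Equiv.Perm.sign τ : ℤ) : ℂ)) * ((Equiv.Perm.sign τ : ℤ) : ℂ) = 1 := by
    rcases Int.units_eq_one_or (Equiv.Perm.sign τ) with h | h <;> simp [h]
  rw [map_smul, PiTensorProduct.reindex_tprod, smul_smul]
  congr 1
  simp only [Equiv.coe_mulRight, map_mul, Equiv.Perm.sign_inv, Units.val_mul, Int.cast_mul]
  linear_combination (-((Equiv.Perm.sign σ : ℤ) : ℂ)) * hτ

/-- `v₁ ∧ ⋯ ∧ v_k = (k!)^{-1/2} ∑_σ sgn(σ) v_{σ(1)} ⊗ ⋯ ⊗ v_{σ(k)}`, as an element of `∧^k V`. -/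
def wedgeVec {k : ℕ} (v : Fin k → V) : antisym k V :=
  ⟨((Real.sqrt k.factorial : ℝ) : ℂ)⁻¹ • altSum v, Submodule.smul_mem _ _ (altSum_mem v)⟩

end Tensor

/-- `e_I = e_{i₁} ∧ ⋯ ∧ e_{i_k}` for the standard basis `e` of `ℂ^n`. -/
def wedgeE {k n : ℕ} (I : Q k n) : antisym k (Fin n → ℂ) :=
  wedgeVec fun p => (Pi.single (I p) 1 : Fin n → ℂ)

lemma sqrt_factorial_ne_zero (k : ℕ) : ((Real.sqrt k.factorial : ℝ) : ℂ) ≠ 0 := by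
  rw [Complex.ofReal_ne_zero]
  exact (Real.sqrt_pos.2 (by exact_mod_cast k.factorial_pos)).ne'

/-- The product of the coordinate functionals at `J`, as a functional on the tensor power. -/
def coordFun {k n : ℕ} (J : Q k n) : (⨂[ℂ] _ : Fin k, (Fin n → ℂ)) →ₗ[ℂ] ℂ :=
  TensorPower.multilinearMapToDual ℂ (Fin n → ℂ) k fun p => LinearMap.proj (J p)

lemma altSum_eq_toTensorPower {V : Type*} [AddCommGroup V] [Module ℂ V] {k : ℕ}
    (v : Fin k → V) :
    altSum v = exteriorPower.toTensorPower ℂ V k (exteriorPower.ιMulti ℂ k v) := by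
  rw [exteriorPower.toTensorPower_apply_ιMulti, altSum]
  refine Finset.sum_congr rfl fun σ _ => ?_
  rcases Int.units_eq_one_or (Equiv.Perm.sign σ) with h | h <;> simp [h]

lemma coordFun_altSum {k n : ℕ} (I J : Q k n) :
    coordFun J (altSum fun p => (Pi.single (I p) 1 : Fin n → ℂ)) = if I = J then 1 else 0 := by
  have key : coordFun J (altSum fun p => (Pi.single (I p) 1 : Fin n → ℂ)) =
      exteriorPower.pairingDual ℂ (Fin n → ℂ) k
        (exteriorPower.ιMulti ℂ k
          ((fun a => (LinearMap.proj a : (Fin n → ℂ) →ₗ[ℂ] ℂ)) ∘ J))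
        (exteriorPower.ιMulti ℂ k ((fun a => (Pi.single a 1 : Fin n → ℂ)) ∘ I)) := by
    rw [altSum_eq_toTensorPower, exteriorPower.pairingDual,
      exteriorPower.alternatingMapLinearEquiv_apply_ιMulti]
    rfl
  rw [key]
  split_ifs with h
  · subst h
    exact exteriorPower.pairingDual_apply_apply_eq_one (R := ℂ) (M := Fin n → ℂ)
      (fun a => (Pi.single a 1 : Fin n → ℂ)) (fun a => LinearMap.proj a)
      (fun i => by simp) (fun i j hij => by simp [hij]) k I
  · exact exteriorPower.pairingDual_apply_apply_eq_one_zero (R := ℂ) (M := Fin n → ℂ)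
      (fun a => (Pi.single a 1 : Fin n → ℂ)) (fun a => LinearMap.proj a)
      (fun i j hij => by simp [hij]) k J I (Ne.symm h)

lemma coordFun_wedgeE {k n : ℕ} (I J : Q k n) :
    coordFun J (wedgeE I : ⨂[ℂ] _ : Fin k, (Fin n → ℂ)) =
      if I = J then ((Real.sqrt k.factorial : ℝ) : ℂ)⁻¹ else 0 := by
  simp only [wedgeE, wedgeVec, map_smul, coordFun_altSum, smul_eq_mul, mul_ite, mul_one, mul_zero]

lemma wedgeE_linearIndependent (k n : ℕ) : LinearIndependent ℂ (wedgeE (k := k) (n := n)) := by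
  rw [Fintype.linearIndependent_iffₛ]
  intro c d hcd J
  have h := congrArg (fun t : antisym k (Fin n → ℂ) => coordFun J t.1) hcd
  simpa [coordFun_wedgeE, sqrt_factorial_ne_zero, Nat.factorial_ne_zero] using h

/-- The antisymmetrization `∑_σ sgn(σ) P_σ` of the tensor power. -/
def altOp (k : ℕ) (V : Type*) [AddCommGroup V] [Module ℂ V] : Module.End ℂ (⨂[ℂ] _ : Fin k, V) :=
  ∑ σ : Equiv.Perm (Fin k),
    ((Equiv.Perm.sign σ : ℤ) : ℂ) • (PiTensorProduct.reindex ℂ (fun _ => V) σ).toLinearMap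

lemma altOp_tprod {V : Type*} [AddCommGroup V] [Module ℂ V] {k : ℕ} (v : Fin k → V) :
    altOp k V (PiTensorProduct.tprod ℂ v) = altSum v := by
  simp only [altOp, altSum, LinearMap.sum_apply, LinearMap.smul_apply]
  refine Fintype.sum_equiv (Equiv.inv _) _ _ fun σ => ?_
  simp only [Equiv.inv_apply, Equiv.Perm.sign_inv]
  congr 1
  exact PiTensorProduct.reindex_tprod σ v

lemma altOp_of_mem {V : Type*} [AddCommGroup V] [Module ℂ V] {k : ℕ}
    {t : ⨂[ℂ] _ : Fin k, V} (ht : t ∈ antisym k V) :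
    altOp k V t = (k.factorial : ℂ) • t := by
  have h : ∀ σ : Equiv.Perm (Fin k), (((Equiv.Perm.sign σ : ℤ) : ℂ) •
      (PiTensorProduct.reindex ℂ (fun _ => V) σ).toLinearMap) t = t := by
    intro σ
    rw [LinearMap.smul_apply]
    erw [ht σ]
    rcases Int.units_eq_one_or (Equiv.Perm.sign σ) with h | h <;> simp [h]
  rw [altOp, LinearMap.sum_apply, Finset.sum_congr rfl fun σ _ => h σ, Finset.sum_const,
    Finset.card_univ, Fintype.card_perm, Fintype.card_fin, Nat.cast_smul_eq_nsmul]

lemma altSum_mem_span {k n : ℕ} (v : Fin k → Fin n → ℂ) :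
    altSum v ∈ Submodule.span ℂ
      (Set.range fun I : Q k n => (wedgeE I : ⨂[ℂ] _ : Fin k, (Fin n → ℂ))) := by
  have hx : exteriorPower.ιMulti ℂ k v ∈ Submodule.span ℂ
      (Set.range (exteriorPower.ιMulti_family ℂ k (Pi.basisFun ℂ (Fin n)))) := by
    rw [exteriorPower.ιMulti_family_span_of_span ℂ (Pi.basisFun ℂ (Fin n)).span_eq]
    trivial
  rw [altSum_eq_toTensorPower]
  have hm := Submodule.mem_map_of_mem (f := exteriorPower.toTensorPower ℂ (Fin n → ℂ) k) hx
  rw [Submodule.map_span] at hm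
  refine Submodule.span_le.2 ?_ hm
  rintro _ ⟨_, ⟨s, rfl⟩, rfl⟩
  have : exteriorPower.toTensorPower ℂ (Fin n → ℂ) k
      (exteriorPower.ιMulti_family ℂ k (Pi.basisFun ℂ (Fin n)) s) =
      ((Real.sqrt k.factorial : ℝ) : ℂ) •
        (wedgeE (Set.powersetCard.ofFinEmbEquiv.symm s) : ⨂[ℂ] _ : Fin k, (Fin n → ℂ)) := by
    rw [exteriorPower.ιMulti_family, ← altSum_eq_toTensorPower, wedgeE, wedgeVec,
      smul_inv_smul₀ (sqrt_factorial_ne_zero k)]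
    congr 1
    ext p
    simp
  rw [this]
  exact Submodule.smul_mem _ _ (Submodule.subset_span ⟨_, rfl⟩)

lemma wedgeE_span (k n : ℕ) : ⊤ ≤ Submodule.span ℂ (Set.range (wedgeE (k := k) (n := n))) := by
  have hall : ∀ t : ⨂[ℂ] _ : Fin k, (Fin n → ℂ), altOp k (Fin n → ℂ) t ∈ Submodule.span ℂ
      (Set.range fun I : Q k n => (wedgeE I : ⨂[ℂ] _ : Fin k, (Fin n → ℂ))) := by
    intro t
    induction t using PiTensorProduct.induction_on with
    | smul_tprod c f =>
      rw [map_smul, altOp_tprod]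
      exact Submodule.smul_mem _ _ (altSum_mem_span f)
    | add x y hx hy =>
      rw [map_add]
      exact Submodule.add_mem _ hx hy
  rintro ⟨t, ht⟩ -
  have h := hall t
  rw [altOp_of_mem ht] at h
  have h2 := Submodule.smul_mem _ ((k.factorial : ℂ)⁻¹) h
  rw [inv_smul_smul₀ (by exact_mod_cast k.factorial_ne_zero)] at h2
  have h3 : (antisym k (Fin n → ℂ)).subtype ⟨t, ht⟩ ∈
      (Submodule.span ℂ (Set.range (wedgeE (k := k) (n := n)))).map
        (antisym k (Fin n → ℂ)).subtype := by
    rw [Submodule.map_span, ← Set.range_comp]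
    exact h2
  obtain ⟨x, hx, hxt⟩ := h3
  have hx' : x = ⟨t, ht⟩ := Subtype.ext hxt
  exact hx' ▸ hx

/-- The basis `(e_I)_{I ∈ Q_{k,n}}` of `∧^k ℂ^n`. -/
def wedgeBasis (k n : ℕ) : Module.Basis (Q k n) ℂ (antisym k (Fin n → ℂ)) :=
  Module.Basis.mk (wedgeE_linearIndependent k n) (wedgeE_span k n)

/-- The operator `∧̃^{n-k} A` on `∧^k ℂ^n`: its matrix with respect to the basis `(e_I)` is the
transpose of the matrix with entries `(-1)^{|I|+|J|} det A(I|J)`. -/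
def tildeWedge {n : ℕ} (k : ℕ) (A : Matrix (Fin n) (Fin n) ℂ) :
    Module.End ℂ (antisym k (Fin n → ℂ)) :=
  Matrix.toLin (wedgeBasis k n) (wedgeBasis k n)
    (Matrix.of fun I J : Q k n => (-1 : ℂ) ^ (weight I + weight J) * (deleted A I J).det).transpose

end CharCoeffDeriv

end

noncomputable section

namespace CharCoeffDeriv

/-! ### The sign of a shuffle -/

/-! `g r` is the sum of the principal `r`-minors (`g_eq_sum`), so on the line `A + t X` it is a sum
of polynomials `det (A_I + t X_I)`. Row multilinearity followed by Laplace expansion along `k` rows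
(`det_rowMix_eq_sum`) gives their `t^k`-coefficient: a signed sum of products of complementary
minors of `A_I` and `X_I`. Multiplied by `k!`, this is the derivative on the diagonal.

That coefficient is the diagonal value of the multilinear, in general not symmetric, form
`minorForm`. Since the derivative is symmetric, polarization (`iteratedFDeriv_of_diag`) recovers it
as the sum of `minorForm` over all orderings of the arguments. The matrix of `wedgeOp` in the basis
`wedgeE` is the average of the same row determinants over orderings, so the sum is `k!` times the
required traces (`sum_minorForm`). -/

/-- Among the values below `I p`, exactly `p` come from the first block, as `I` is increasing; the
others come from the second and are the inversions that `sign_shuffle` counts. -/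
lemma card_lt_add_card_lt {k l : ℕ} (I : Fin k ↪o Fin (k + l)) (e : Equiv.Perm (Fin (k + l)))
    (hI : ∀ p, e (Fin.castAdd l p) = I p) (p : Fin k) :
    (p : ℕ) + (Finset.univ.filter fun q : Fin l => e (Fin.natAdd k q) < I p).card = I p := by
  have h1 : (Finset.univ.filter fun i : Fin (k + l) => e i < I p).card = I p := by
    rw [← Fin.card_Iio (I p)]
    refine Finset.card_bij (fun i _ => e i) (fun i hi => by simpa using hi)
      (fun i _ j _ h => e.injective h) fun j hj => ⟨e.symm j, by simpa using hj, by simp⟩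
  rw [← h1]
  simp only [Finset.card_filter]
  rw [Fin.sum_univ_add]
  simp only [hI, OrderEmbedding.lt_iff_lt]
  congr 1
  rw [← Finset.card_filter]
  rw [← Fin.card_Iio p]
  congr 1
  ext q
  simp

/-- Both blocks are increasing, so every inversion pairs a position of the first block with one of
the second. -/
lemma sign_shuffle {k l : ℕ} (I : Fin k ↪o Fin (k + l)) (I' : Fin l ↪o Fin (k + l))
    (e : Equiv.Perm (Fin (k + l))) (hI : ∀ p, e (Fin.castAdd l p) = I p)
    (hI' : ∀ q, e (Fin.natAdd k q) = I' q) :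
    Equiv.Perm.sign e = (-1) ^ ∑ p, ((I p : ℕ) + p) := by
  have key : Equiv.Perm.sign e = ∏ i, ∏ j, if i < j ∧ e j < e i then (-1 : ℤˣ) else 1 := by
    rw [Equiv.Perm.sign_eq_prod_prod_Ioi]
    refine Finset.prod_congr rfl fun i _ => ?_
    rw [← Finset.filter_lt_eq_Ioi, Finset.prod_filter]
    refine Finset.prod_congr rfl fun j _ => ?_
    by_cases h : i < j
    · rcases lt_trichotomy (e i) (e j) with h' | h' | h'
      · simp [h', h'.not_gt]
      · exact absurd (e.injective h') h.ne
      · simp [h, h', h'.not_gt]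
    · simp [h]
  rw [key, Fin.prod_univ_add]
  have h2 : ∏ q : Fin l, ∏ j, (if Fin.natAdd k q < j ∧ e j < e (Fin.natAdd k q)
      then (-1 : ℤˣ) else 1) = 1 := by
    refine Finset.prod_eq_one fun q _ => Finset.prod_eq_one fun j _ => if_neg ?_
    refine Fin.addCases (fun p => ?_) (fun q' => ?_) j
    · rintro ⟨h, -⟩
      rw [Fin.lt_def] at h
      simp at h
      omega
    · rintro ⟨h, h'⟩
      rw [hI', hI', OrderEmbedding.lt_iff_lt] at h'
      rw [Fin.lt_def] at h h'
      simp at h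
      omega
  rw [h2, mul_one, ← Finset.prod_pow_eq_pow_sum]
  refine Finset.prod_congr rfl fun p _ => ?_
  rw [Fin.prod_univ_add]
  have h3 : ∏ p' : Fin k, (if Fin.castAdd l p < Fin.castAdd l p' ∧
      e (Fin.castAdd l p') < e (Fin.castAdd l p) then (-1 : ℤˣ) else 1) = 1 := by
    refine Finset.prod_eq_one fun p' _ => if_neg ?_
    rintro ⟨h, h'⟩
    rw [hI, hI, OrderEmbedding.lt_iff_lt] at h'
    rw [Fin.lt_def] at h h'
    simp at h
    omega
  have h4 : ∀ q : Fin l, (Fin.castAdd l p < Fin.natAdd k q) := fun q => by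
    rw [Fin.lt_def]; simp; omega
  rw [h3, one_mul]
  simp only [h4, true_and, hI]
  rw [← Finset.prod_filter, Finset.prod_const]
  have h5 := card_lt_add_card_lt I e hI p
  -- Position `p` has `I p - p` inversions, which has the parity of `I p + p`.
  rw [neg_one_pow_congr]
  rw [Nat.even_add, ← h5, Nat.even_add]
  tauto

/-! ### Laplace expansion along several rows -/

variable {R : Type*} [CommRing R]

/-- The matrix with the rows in `s` taken from `Y` and the other rows from `A`. -/
def rowMix {m : ℕ} (s : Finset (Fin m)) (Y A : Matrix (Fin m) (Fin m) R) :
    Matrix (Fin m) (Fin m) R :=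
  Matrix.of fun i j => if i ∈ s then Y i j else A i j

/-- The matrix agreeing with `Y` on `s × t`, with `A` on the product of the complements, and
vanishing elsewhere. -/
def checker {m : ℕ} (A Y : Matrix (Fin m) (Fin m) R) (s t : Finset (Fin m)) :
    Matrix (Fin m) (Fin m) R :=
  Matrix.of fun i j => if i ∈ s then (if j ∈ t then Y i j else 0) else
    (if j ∈ t then 0 else A i j)

/-- The Leibniz term of `σ` can be nonzero in only one `checker`, the one whose column set is the
preimage of `s` under `σ`; there it equals the term of `rowMix`. -/
lemma det_rowMix_eq_sum_checker {m : ℕ} (A Y : Matrix (Fin m) (Fin m) R)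
    (s : Finset (Fin m)) :
    (rowMix s Y A).det =
      ∑ t ∈ Finset.univ.powersetCard s.card, (checker A Y s t).det := by
  simp only [Matrix.det_apply]
  rw [Finset.sum_comm]
  refine Finset.sum_congr rfl fun σ _ => ?_
  rw [← Finset.smul_sum ]
  congr 1
  rw [Finset.sum_eq_single (s.map σ.symm.toEmbedding)]
  · refine Finset.prod_congr rfl fun i _ => ?_
    by_cases h : σ i ∈ s
    · simp [checker, rowMix, h]
    · simp [checker, rowMix, h]
  · intro t ht hne
    have : ¬ ∀ i, (i ∈ t ↔ σ i ∈ s) := fun h => hne (by ext i; simp [h])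
    push Not at this
    obtain ⟨i, hi⟩ := this
    refine Finset.prod_eq_zero (Finset.mem_univ i) ?_
    rcases hi with ⟨h1, h2⟩ | ⟨h1, h2⟩ <;> simp [checker, h1, h2]
  · intro h
    exact absurd (by simp [Finset.mem_powersetCard]) h

/-- Moving the rows `J` and the columns `K` to the front makes the matrix block diagonal;
`sign_shuffle` gives the signs of the two permutations. -/
lemma det_checker_aux {k l : ℕ} (A Y : Matrix (Fin (k + l)) (Fin (k + l)) R)
    (J K : Fin k ↪o Fin (k + l)) (J' K' : Fin l ↪o Fin (k + l))
    (hJ : ∀ p q, J p ≠ J' q) (hK : ∀ p q, K p ≠ K' q) :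
    (checker A Y (Finset.univ.map J.toEmbedding) (Finset.univ.map K.toEmbedding)).det =
      (-1) ^ (∑ p, ((J p : ℕ) + p) + ∑ p, ((K p : ℕ) + p)) *
        ((A.submatrix J' K').det * (Y.submatrix J K).det) := by
  have mk : ∀ (I : Fin k ↪o Fin (k + l)) (I' : Fin l ↪o Fin (k + l)), (∀ p q, I p ≠ I' q) →
      ∃ e : Equiv.Perm (Fin (k + l)), (∀ p, e (Fin.castAdd l p) = I p) ∧
        ∀ q, e (Fin.natAdd k q) = I' q := by
    intro I I' h
    have hinj : Function.Injective (Fin.append I I') := by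
      rw [Fin.append_injective_iff]
      exact ⟨I.injective, I'.injective, h⟩
    exact ⟨Equiv.ofBijective _ (Finite.injective_iff_bijective.1 hinj), by simp, by simp⟩
  obtain ⟨e, he, he'⟩ := mk J J' hJ
  obtain ⟨f, hf, hf'⟩ := mk K K' hK
  have hsub : ((checker A Y (Finset.univ.map J.toEmbedding)
      (Finset.univ.map K.toEmbedding)).submatrix e f).submatrix
        (finSumFinEquiv (m := k) (n := l)) finSumFinEquiv =
      Matrix.fromBlocks (Y.submatrix J K) 0 0 (A.submatrix J' K') := by
    ext i j
    rcases i with p | p <;> rcases j with q | q <;>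
      simp [checker, he, hf, he', hf', hJ, hK]
  have h1 : ((checker A Y (Finset.univ.map J.toEmbedding)
      (Finset.univ.map K.toEmbedding)).submatrix e f).det =
      (Y.submatrix J K).det * (A.submatrix J' K').det := by
    rw [← Matrix.det_fromBlocks_zero₂₁ _ 0, ← hsub, Matrix.det_submatrix_equiv_self]
  set M := checker A Y (Finset.univ.map J.toEmbedding) (Finset.univ.map K.toEmbedding)
  have h2 : (M.submatrix e f).det =
      (Equiv.Perm.sign e : ℤˣ) * ((Equiv.Perm.sign f : ℤˣ) * M.det) := by
    rw [← Matrix.det_permute' f M, ← Matrix.det_permute e]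
    rfl
  rw [sign_shuffle J J' e he he', sign_shuffle K K' f hf hf'] at h2
  push_cast at h2
  have h3 : ∀ a : ℕ, ((-1 : R) ^ a) * (-1) ^ a = 1 := fun a => by
    rw [← mul_pow]; simp
  rw [mul_comm (A.submatrix J' K').det, ← h1, h2, pow_add]
  generalize (∑ p, ((J p : ℕ) + p)) = a
  generalize (∑ p, ((K p : ℕ) + p)) = b
  linear_combination (-(M.det) * (-1) ^ b * (-1) ^ b) * h3 a - M.det * h3 b

lemma ne_compl {k n : ℕ} (I : Q k n) (p : Fin k) (q : Fin (n - k)) : I p ≠ compl I q := by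
  intro h
  have hq : compl I q ∈ (Finset.univ.map I.toEmbedding)ᶜ := Finset.orderEmbOfFin_mem _ _ q
  rw [← h] at hq
  simp at hq

lemma Q_le {k n : ℕ} (I : Q k n) : k ≤ n := by
  simpa using Fintype.card_le_of_injective I I.injective

lemma det_checker {k m : ℕ} (A Y : Matrix (Fin m) (Fin m) ℂ) (J K : Q k m) :
    (checker A Y (Finset.univ.map J.toEmbedding) (Finset.univ.map K.toEmbedding)).det =
      (-1) ^ (weight J + weight K) * ((deleted A J K).det * (Y.submatrix J K).det) := by
  -- A free `l` allows substituting `m = k + l`, which is impossible with `m - k` in its place.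
  have gen : ∀ l (h : m = k + l) (J' K' : Fin l ↪o Fin m)
      (_ : ∀ p q, J p ≠ J' q) (_ : ∀ p q, K p ≠ K' q),
      (checker A Y (Finset.univ.map J.toEmbedding) (Finset.univ.map K.toEmbedding)).det =
      (-1) ^ (∑ p, ((J p : ℕ) + p) + ∑ p, ((K p : ℕ) + p)) *
        ((A.submatrix J' K').det * (Y.submatrix J K).det) := by
    intro l h J' K' hJ hK
    subst h
    exact det_checker_aux A Y J K J' K' hJ hK
  rw [gen (m - k) (Nat.add_sub_cancel' (Q_le J)).symm (compl J) (compl K) (ne_compl J) (ne_compl K)]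
  congr 1
  -- The exponents differ by an even number: `p` against the shift `1` in `weight`, each summed once
  -- for `J` and once for `K`.
  rw [neg_one_pow_congr]
  simp only [weight, Finset.sum_add_distrib]
  grind

lemma sum_powersetCard_eq_sum_Q {M : Type*} [AddCommMonoid M] {k m : ℕ}
    (F : Finset (Fin m) → M) :
    ∑ s ∈ Finset.univ.powersetCard k, F s = ∑ I : Q k m, F (Finset.univ.map I.toEmbedding) := by
  symm
  refine Finset.sum_bij (fun I _ => Finset.univ.map I.toEmbedding) (fun I _ => ?_)
    (fun I _ J _ h => ?_) (fun s hs => ?_) (fun _ _ => rfl)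
  · simp [Finset.mem_powersetCard]
  · have hc : (Finset.univ.map I.toEmbedding).card = k := by simp
    rw [Finset.orderEmbOfFin_unique' hc (f := I) (by simp),
      Finset.orderEmbOfFin_unique' hc (f := J) (by rw [h]; simp)]
  · have hc := (Finset.mem_powersetCard.1 hs).2
    refine ⟨s.orderEmbOfFin hc, Finset.mem_univ _, ?_⟩
    ext i
    have := Finset.range_orderEmbOfFin s hc
    rw [Set.ext_iff] at this
    simp

lemma det_rowMix_eq_sum {k m : ℕ} (A Y : Matrix (Fin m) (Fin m) ℂ) (J : Q k m) :
    (rowMix (Finset.univ.map J.toEmbedding) Y A).det =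
      ∑ K : Q k m, (-1) ^ (weight J + weight K) *
        ((deleted A J K).det * (Y.submatrix J K).det) := by
  rw [det_rowMix_eq_sum_checker, Finset.card_map, Finset.card_univ, Fintype.card_fin,
    sum_powersetCard_eq_sum_Q]
  exact Finset.sum_congr rfl fun K _ => det_checker A Y J K

/-! ### Coefficients of `det (A + t Y)`, and `g` as a sum of principal minors -/

lemma det_add_smul {m : ℕ} (A Y : Matrix (Fin m) (Fin m) ℂ) (t : ℂ) :
    (A + t • Y).det = ∑ s : Finset (Fin m),
      t ^ s.card * (rowMix s Y A).det := by
  have h := (Matrix.detRowAlternating (R := ℂ) (n := Fin m)).map_add_univ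
    (fun i => t • Y i) (fun i => A i)
  have h0 : (A + t • Y).det =
      Matrix.detRowAlternating ((fun i => t • Y i) + fun i => A i) := by
    rw [add_comm]; rfl
  rw [h0, h]
  refine Finset.sum_congr rfl fun s _ => ?_
  -- The scaling factor depends on the row index, so this pulls one `t` out of each row in `s`.
  have h1 := Matrix.det_mul_column (fun i => if i ∈ s then t else 1) (rowMix s Y A)
  simp only [Finset.prod_ite_mem, Finset.univ_inter, Finset.prod_const] at h1
  rw [← h1]
  refine congrArg Matrix.det (Matrix.ext fun i j => ?_)
  by_cases hi : i ∈ s <;> simp [rowMix, hi]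

open Polynomial in
/-- The polynomial `det (A + X Y)`, written out by minors. -/
def detPoly {m : ℕ} (A Y : Matrix (Fin m) (Fin m) ℂ) : ℂ[X] :=
  ∑ s : Finset (Fin m), C ((rowMix s Y A).det) * X ^ s.card

lemma eval_detPoly {m : ℕ} (A Y : Matrix (Fin m) (Fin m) ℂ) (t : ℂ) :
    (detPoly A Y).eval t = (A + t • Y).det := by
  rw [det_add_smul, detPoly, Polynomial.eval_finsetSum]
  exact Finset.sum_congr rfl fun s _ => by
    rw [Polynomial.eval_C_mul, Polynomial.eval_pow, Polynomial.eval_X, mul_comm]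

lemma coeff_detPoly {m : ℕ} (A Y : Matrix (Fin m) (Fin m) ℂ) (k : ℕ) :
    (detPoly A Y).coeff k = ∑ J : Q k m, ∑ K : Q k m, (-1) ^ (weight J + weight K) *
        ((deleted A J K).det * (Y.submatrix J K).det) := by
  simp only [detPoly, Polynomial.finsetSum_coeff, Polynomial.coeff_C_mul_X_pow]
  rw [← Finset.sum_filter]
  have : (Finset.univ.filter fun s : Finset (Fin m) => k = s.card) =
      Finset.univ.powersetCard k := by
    ext s; simp [Finset.mem_powersetCard, eq_comm]
  rw [this, sum_powersetCard_eq_sum_Q]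
  exact Finset.sum_congr rfl fun J _ => det_rowMix_eq_sum A Y J

lemma g_eq_sum {n r : ℕ} (hrn : r ≤ n) (A : Matrix (Fin n) (Fin n) ℂ) :
    g r A = ∑ I : Q r n, (principal A I).det := by
  have h := Matrix.charpoly_coeff_eq_sum_minors A r (by simpa using hrn)
  rw [Fintype.card_fin] at h
  rw [g, h, ← mul_assoc, ← mul_pow]
  simp only [mul_neg, mul_one, neg_neg, one_pow, one_mul]
  rw [sum_powersetCard_eq_sum_Q]
  -- The signs have cancelled; what remains is to reindex each minor from the subtype of a finset to
  -- `Fin r`.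
  refine Finset.sum_congr rfl fun I _ => ?_
  have hb : Function.Bijective fun p : Fin r =>
      (⟨I p, by simp⟩ : (Finset.univ.map I.toEmbedding : Finset (Fin n))) := by
    refine ⟨fun p q h => I.injective (congrArg Subtype.val h), fun ⟨i, hi⟩ => ?_⟩
    obtain ⟨p, -, hp⟩ := Finset.mem_map.1 hi
    exact ⟨p, Subtype.ext hp⟩
  rw [← Matrix.det_submatrix_equiv_self (Equiv.ofBijective _ hb)]
  rfl

/-! ### Traces on the antisymmetric tensor power -/

/-- The alternating sum `∑_τ sgn(τ) ∏_p Y^p_{p, τ(p)}`, the determinant with the `p`-th row taken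
from `Y^p`. -/
def rowDet {k : ℕ} (Y : Fin k → Matrix (Fin k) (Fin k) ℂ) : ℂ :=
  ∑ τ : Equiv.Perm (Fin k), ((Equiv.Perm.sign τ : ℤ) : ℂ) * ∏ p, Y p p (τ p)

lemma rowDet_const {k : ℕ} (Y : Matrix (Fin k) (Fin k) ℂ) : rowDet (fun _ => Y) = Y.det := by
  rw [← Matrix.det_transpose, Matrix.det_apply']
  rfl

lemma wedgeBasis_apply {k n : ℕ} (I : Q k n) : wedgeBasis k n I = wedgeE I :=
  Module.Basis.mk_apply _ _ I

/-- The factor undoes the normalization `(k!)^{-1/2}` of `wedgeE`. -/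
lemma wedgeBasis_repr {k n : ℕ} (t : antisym k (Fin n → ℂ)) (J : Q k n) :
    (wedgeBasis k n).repr t J =
      ((Real.sqrt k.factorial : ℝ) : ℂ) * coordFun J (t : ⨂[ℂ] _ : Fin k, (Fin n → ℂ)) := by
  have h : (wedgeBasis k n).coord J = ((Real.sqrt k.factorial : ℝ) : ℂ) •
      (coordFun J ∘ₗ (antisym k (Fin n → ℂ)).subtype) := by
    refine (wedgeBasis k n).ext fun I => ?_
    have := sqrt_factorial_ne_zero k
    rw [Module.Basis.coord_apply, Module.Basis.repr_self, wedgeBasis_apply]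
    simp only [LinearMap.smul_apply, LinearMap.comp_apply, Submodule.subtype_apply,
      coordFun_wedgeE, smul_eq_mul,
      Finsupp.single_apply]
    split_ifs <;> simp [this]
  exact congrArg (fun f => f t) h

/-- Slot `p` pairs the coordinate `J p` with `Y p` applied to the basis vector at `I (τ p)`: tensor
slots become rows, and the antisymmetrization permutes columns. -/
lemma coordFun_map_altSum {k n : ℕ} (I J : Q k n) (Y : Fin k → Matrix (Fin n) (Fin n) ℂ) :
    coordFun J (PiTensorProduct.map (fun p => Matrix.toLin' (Y p))
      (altSum fun p => (Pi.single (I p) 1 : Fin n → ℂ))) =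
      rowDet fun p => (Y p).submatrix J I := by
  simp only [altSum, map_sum, map_smul, PiTensorProduct.map_tprod, rowDet, smul_eq_mul, coordFun]
  refine Finset.sum_congr rfl fun τ _ => ?_
  congr 1
  erw [TensorPower.multilinearMapToDual_apply_tprod]
  refine Finset.prod_congr rfl fun p _ => ?_
  simp

lemma toMatrix_wedgeOp {k n : ℕ} (Y : Fin k → Matrix (Fin n) (Fin n) ℂ) (J I : Q k n) :
    LinearMap.toMatrix (wedgeBasis k n) (wedgeBasis k n)
      (wedgeOp fun p => Matrix.toLin' (Y p)) J I =
      (k.factorial : ℂ)⁻¹ * ∑ σ : Equiv.Perm (Fin k),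
        rowDet fun p => (Y (σ p)).submatrix J I := by
  rw [LinearMap.toMatrix_apply, wedgeBasis_repr, wedgeBasis_apply]
  simp only [wedgeOp, LinearMap.coe_restrict_apply, wedgeE, wedgeVec, map_smul, symTensor,
    LinearMap.smul_apply, LinearMap.sum_apply, map_sum, smul_eq_mul]
  rw [mul_inv_cancel_left₀ (sqrt_factorial_ne_zero k)]
  congr 1
  exact Finset.sum_congr rfl fun σ _ => coordFun_map_altSum I J fun p => Y (σ p)

lemma wedgeOp_const {k : ℕ} {V : Type*} [AddCommGroup V] [Module ℂ V] (X : Module.End ℂ V) :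
    wedgeOp (fun _ : Fin k => X) = wedgePow k X := by
  ext t
  simp only [wedgeOp, wedgePow, LinearMap.coe_restrict_apply, symTensor, Finset.sum_const,
    Finset.card_univ, Fintype.card_perm, Fintype.card_fin]
  rw [← Nat.cast_smul_eq_nsmul ℂ, smul_smul,
    inv_mul_cancel₀ (by exact_mod_cast k.factorial_ne_zero), one_smul]

lemma trace_tildeWedge_wedgeOp {k n : ℕ} (A : Matrix (Fin n) (Fin n) ℂ)
    (Y : Fin k → Matrix (Fin n) (Fin n) ℂ) :
    LinearMap.trace ℂ _ (tildeWedge k A ∘ₗ wedgeOp fun p => Matrix.toLin' (Y p)) =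
      (k.factorial : ℂ)⁻¹ * ∑ J : Q k n, ∑ K : Q k n,
        ((-1) ^ (weight J + weight K) * (deleted A J K).det) *
          ∑ σ : Equiv.Perm (Fin k), rowDet fun p => (Y (σ p)).submatrix J K := by
  -- After cyclic commutation, the transpose in `tildeWedge` makes the trace an entrywise pairing of
  -- the two matrices.
  rw [LinearMap.trace_eq_matrix_trace ℂ (wedgeBasis k n),
    LinearMap.toMatrix_comp _ (wedgeBasis k n), tildeWedge, LinearMap.toMatrix_toLin,
    Matrix.trace_mul_comm, Matrix.trace, Finset.mul_sum]
  refine Finset.sum_congr rfl fun J _ => ?_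
  rw [Matrix.diag_apply, Matrix.mul_apply, Finset.mul_sum]
  refine Finset.sum_congr rfl fun K _ => ?_
  rw [toMatrix_wedgeOp, Matrix.transpose_apply, Matrix.of_apply]
  ring

/-! ### Analysis -/

/-- The entry functional on matrices. -/
def entryL {n : ℕ} (i j : Fin n) : Matrix (Fin n) (Fin n) ℂ →L[ℂ] ℂ :=
  LinearMap.toContinuousLinearMap (Matrix.entryLinearMap ℂ ℂ i j)

lemma entryL_apply {n : ℕ} (i j : Fin n) (A : Matrix (Fin n) (Fin n) ℂ) :
    entryL i j A = A i j := rfl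

/-- `N` is free because both smoothness and the analytic order `⊤ : WithTop ℕ∞` are used. -/
lemma contDiff_g {n r : ℕ} (hrn : r ≤ n) {N : WithTop ℕ∞} :
    ContDiff ℂ N (fun A : Matrix (Fin n) (Fin n) ℂ => g r A) := by
  simp only [g_eq_sum hrn, Matrix.det_apply']
  refine ContDiff.sum fun I _ => ContDiff.sum fun σ _ => contDiff_const.mul ?_
  exact contDiff_prod fun p _ => (entryL (I (σ p)) (I p)).contDiff

/-- `rowDet` of submatrices, as a continuous multilinear map. -/
def rowDetL {k n : ℕ} (a b : Fin k → Fin n) :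
    ContinuousMultilinearMap ℂ (fun _ : Fin k => Matrix (Fin n) (Fin n) ℂ) ℂ :=
  ∑ τ : Equiv.Perm (Fin k), ((Equiv.Perm.sign τ : ℤ) : ℂ) •
    (ContinuousMultilinearMap.mkPiAlgebra ℂ (Fin k) ℂ).compContinuousLinearMap
      fun p => entryL (a p) (b (τ p))

lemma rowDetL_apply {k n : ℕ} (a b : Fin k → Fin n) (Y : Fin k → Matrix (Fin n) (Fin n) ℂ) :
    rowDetL a b Y = rowDet fun p => (Y p).submatrix a b := by
  simp [rowDetL, rowDet, entryL_apply]

lemma iteratedDeriv_eval_polynomial (p : Polynomial ℂ) (k : ℕ) :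
    iteratedDeriv k (fun t : ℂ => p.eval t) 0 = k.factorial * p.coeff k := by
  have h : iteratedDeriv k (fun t : ℂ => p.eval t) =
      fun t => (Polynomial.derivative^[k] p).eval t := by
    induction k with
    | zero => rfl
    | succ k ih =>
      rw [iteratedDeriv_succ, ih]
      funext t
      rw [Polynomial.deriv, Function.iterate_succ_apply']
  rw [h]
  simp only [← Polynomial.coeff_zero_eq_eval_zero, Polynomial.coeff_iterate_derivative, zero_add,
    Nat.descFactorial_self, nsmul_eq_mul]

/-- The line is a translate of the linear map `t ↦ t • v`, so the chain rule has no higher-order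
terms. -/
lemma iteratedFDeriv_diag_eq_iteratedDeriv {E : Type*} [NormedAddCommGroup E] [NormedSpace ℂ E]
    {f : E → ℂ} (hf : ContDiff ℂ (⊤ : ℕ∞) f) (k : ℕ) (x v : E) :
    iteratedFDeriv ℂ k f x (fun _ => v) = iteratedDeriv k (fun t : ℂ => f (x + t • v)) 0 := by
  have hf' : ContDiff ℂ (⊤ : ℕ∞) fun z => f (x + z) := hf.comp (contDiff_const.add contDiff_id)
  have h := ContinuousLinearMap.iteratedFDeriv_comp_right
    (ContinuousLinearMap.toSpanSingleton ℂ v) hf' (0 : ℂ) (i := k) (by exact_mod_cast le_top)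
  rw [iteratedDeriv_eq_iteratedFDeriv]
  have h2 : (fun t : ℂ => f (x + t • v)) =
      (fun z => f (x + z)) ∘ ContinuousLinearMap.toSpanSingleton ℂ v := by
    funext t; simp
  rw [h2, h, iteratedFDeriv_comp_add_left]
  simp

/-- Polarization: the iterated derivative is determined by its values on the diagonal. -/
lemma iteratedFDeriv_of_diag {E : Type*} [NormedAddCommGroup E] [NormedSpace ℂ E]
    {f : E → ℂ} {x : E} {k : ℕ} (hf : ContDiffAt ℂ ⊤ f x)
    (Φ : ContinuousMultilinearMap ℂ (fun _ : Fin k => E) ℂ)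
    (h : ∀ v, iteratedFDeriv ℂ k f x (fun _ => v) = k.factorial * Φ fun _ => v)
    (v : Fin k → E) :
    iteratedFDeriv ℂ k f x v = ∑ σ : Equiv.Perm (Fin k), Φ fun p => v (σ p) := by
  -- The `k`-th derivative of `w ↦ Φ (w, …, w)` is the sum of `Φ` over all orderings of `v`; this is
  -- applied to both sides of `h`.
  have h1 := ContinuousMultilinearMap.iteratedFDeriv_comp_diagonal
    (iteratedFDeriv ℂ k f x) (0 : E) v
  have h2 := ContinuousMultilinearMap.iteratedFDeriv_comp_diagonal
    ((k.factorial : ℂ) • Φ) (0 : E) v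
  have h3 : (fun w : E => iteratedFDeriv ℂ k f x fun _ => w) =
      fun w => ((k.factorial : ℂ) • Φ) fun _ => w := by
    funext w; simp [h]
  rw [h3, h2] at h1
  -- By symmetry of the derivative, its sum over orderings is `k!` equal terms, and this `k!`
  -- cancels against the one in `h`.
  have h4 : ∀ σ : Equiv.Perm (Fin k), iteratedFDeriv ℂ k f x (fun i => v (σ i)) =
      iteratedFDeriv ℂ k f x v := fun σ => hf.iteratedFDeriv_comp_perm v σ
  simp only [h4, Finset.sum_const, Finset.card_univ, Fintype.card_perm, Fintype.card_fin,
    _root_.smul_apply, smul_eq_mul, ← Finset.mul_sum, nsmul_eq_mul] at h1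
  exact (mul_left_cancel₀ (by exact_mod_cast k.factorial_ne_zero) h1).symm

/-- The multilinear map whose value on the diagonal is the degree `k` part of `g r` at `A`. -/
def minorForm {n : ℕ} (k r : ℕ) (A : Matrix (Fin n) (Fin n) ℂ) :
    ContinuousMultilinearMap ℂ (fun _ : Fin k => Matrix (Fin n) (Fin n) ℂ) ℂ :=
  ∑ I : Q r n, ∑ J : Q k r, ∑ K : Q k r,
    ((-1) ^ (weight J + weight K) * (deleted (principal A I) J K).det) •
      rowDetL (fun p => I (J p)) fun p => I (K p)

lemma minorForm_apply {n : ℕ} (k r : ℕ) (A : Matrix (Fin n) (Fin n) ℂ)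
    (X : Fin k → Matrix (Fin n) (Fin n) ℂ) :
    minorForm k r A X = ∑ I : Q r n, ∑ J : Q k r, ∑ K : Q k r,
      ((-1) ^ (weight J + weight K) * (deleted (principal A I) J K).det) *
        rowDet fun p => (principal (X p) I).submatrix J K := by
  simp only [minorForm, _root_.sum_apply, _root_.smul_apply,
    rowDetL_apply, smul_eq_mul]
  rfl

lemma iteratedFDeriv_g_diag {n r : ℕ} (hrn : r ≤ n) (k : ℕ) (A X : Matrix (Fin n) (Fin n) ℂ) :
    iteratedFDeriv ℂ k (fun B : Matrix (Fin n) (Fin n) ℂ => g r B) A (fun _ => X) =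
      k.factorial * minorForm k r A fun _ => X := by
  rw [iteratedFDeriv_diag_eq_iteratedDeriv (contDiff_g hrn)]
  have h : (fun t : ℂ => g r (A + t • X)) =
      fun t => (∑ I : Q r n, detPoly (principal A I) (principal X I)).eval t := by
    funext t
    rw [g_eq_sum hrn, Polynomial.eval_finsetSum]
    exact Finset.sum_congr rfl fun I _ => by rw [eval_detPoly]; rfl
  rw [h, iteratedDeriv_eval_polynomial, minorForm_apply]
  -- On the diagonal all rows come from the same matrix, so each `rowDet` is a true minor.
  simp only [Polynomial.finsetSum_coeff, coeff_detPoly, rowDet_const, mul_assoc]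

lemma sum_minorForm {n k r : ℕ} (A : Matrix (Fin n) (Fin n) ℂ)
    (X : Fin k → Matrix (Fin n) (Fin n) ℂ) :
    ∑ σ : Equiv.Perm (Fin k), minorForm k r A (fun p => X (σ p)) =
      (k.factorial : ℂ) * ∑ I : Q r n,
          LinearMap.trace ℂ _ (tildeWedge k (principal A I) ∘ₗ
            wedgeOp fun j => Matrix.toLin' (principal (X j) I)) := by
  simp only [minorForm_apply]
  rw [Finset.sum_comm, Finset.mul_sum]
  refine Finset.sum_congr rfl fun I _ => ?_
  -- The outer `k!` cancels the averaging factor in `wedgeOp`; only interchanges of sums remain.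
  rw [trace_tildeWedge_wedgeOp, mul_inv_cancel_left₀ (by exact_mod_cast k.factorial_ne_zero),
    Finset.sum_comm]
  refine Finset.sum_congr rfl fun J _ => ?_
  rw [Finset.sum_comm]
  refine Finset.sum_congr rfl fun K _ => ?_
  rw [Finset.mul_sum]

end CharCoeffDeriv
end

open CharCoeffDeriv in
theorem theorem3p3 (n k r : ℕ) (hk : 1 ≤ k) (hkn : k ≤ n) (hr : 1 ≤ r) (hrn : r ≤ n) :
    ContDiff ℂ (⊤ : ℕ∞) (fun A : Matrix (Fin n) (Fin n) ℂ => g r A) ∧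
    (∀ (A : Matrix (Fin n) (Fin n) ℂ) (X : Fin k → Matrix (Fin n) (Fin n) ℂ),
      iteratedFDeriv ℂ k (fun B : Matrix (Fin n) (Fin n) ℂ => g r B) A X =
        (k.factorial : ℂ) * ∑ I : Q r n,
          LinearMap.trace ℂ _ (tildeWedge k (principal A I) ∘ₗ
            wedgeOp fun j => Matrix.toLin' (principal (X j) I))) ∧
    (∀ A X : Matrix (Fin n) (Fin n) ℂ,
      iteratedFDeriv ℂ k (fun B : Matrix (Fin n) (Fin n) ℂ => g r B) A (fun _ => X) =
        (k.factorial : ℂ) * ∑ I : Q r n,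
          LinearMap.trace ℂ _ (tildeWedge k (principal A I) ∘ₗ
            wedgePow k (Matrix.toLin' (principal X I)))) := by
  have main : ∀ (A : Matrix (Fin n) (Fin n) ℂ) (X : Fin k → Matrix (Fin n) (Fin n) ℂ),
      iteratedFDeriv ℂ k (fun B : Matrix (Fin n) (Fin n) ℂ => g r B) A X =
        (k.factorial : ℂ) * ∑ I : Q r n,
          LinearMap.trace ℂ _ (tildeWedge k (principal A I) ∘ₗ
            wedgeOp fun j => Matrix.toLin' (principal (X j) I)) := fun A X => by
    rw [← sum_minorForm]
    exact iteratedFDeriv_of_diag (contDiff_g hrn).contDiffAt _ (iteratedFDeriv_g_diag hrn k A) X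
  refine ⟨contDiff_g hrn, main, fun A X => ?_⟩
  rw [main]
  simp only [wedgeOp_const]
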